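/- **Notions of normality.** Let $U\subseteq\mathbb C^2$ be open and let $\mathcal F$ be a family of holomorphic maps $U\to\mathbb C^2$. Write $\widehat{\mathbb C}=\mathbb C\cup\{\infty\}$ for the Riemann sphere. * $\mathcal F$ is *$\widehat{\mathbb C^2}$-normal* on $U$ if every sequence in $\mathcal F$ either diverges to $\infty$ uniformly on compact subsets of $U$, or has a subsequence converging uniformly on compact subsets of $U$ to a holomorphic map $U\to\mathbb C^2$. * $\mathcal F$ is *$\mathbb P^2$-normal* on $U$ if every sequence in $\mathcal F$ has a subsequence converging uniformly on compact subsets of $U$ (with respect to the Fubini–Study distance) to a holomorphic map $U\to\mathbb P^2(\mathbb C)$, where $\mathbb C^2\subset\mathbb P^2(\mathbb C)$ via $(z,w)\mapsto[1:z:w]$. * $\mathcal F$ is *$(\widehat{\mathbb C})^2$-normal* on $U$ if every sequence in $\mathcal F$ has a subsequence converging uniformly on compact subsets of $U$ (with respect to the chordal distance in each factor) to a holomorphic map $U\to\widehat{\mathbb C}\times\widehat{\mathbb C}$. For a holomorphic map $F\colon\mathbb C^2\to\mathbb C^2$ and each of these three notions, the *Fatou set* of $F$ is the set of points having an open neighbourhood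 on which the family of iterates $\{F^n : n\in\mathbb N\}$ is normal, and the *Julia set* of $F$ is its complement in $\mathbb C^2$. **Theorem 1.1.** Let $f,g\colon\mathbb C\to\mathbb C$ be nonconstant entire functions with $g(0)=0$. Let $z_0\in\mathbb C$ be a point such that $f^{n_k}(z_0)\to\infty$ as $k\to\infty$ for some strictly increasing sequence $(n_k)$ of natural numbers. Then there exists an entire function $h\colon\mathbb C\to\mathbb C$ such that the point $(z_0,0)$ belongs to the Julia set of the skew-product $$F\colon\mathbb C^2\to\mathbb C^2,\qquad F(z,w)=\bigl(f(z)+w\,h(z),\,g(w)\bigr),$$ with respect to each of the three notions of normality: $\widehat{\mathbb C^2}$, $\mathbb P^2$ and $(\widehat{\mathbb C})^2$. -/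

import Mathlib

open Filter Topology
open scoped LinearAlgebra.Projectivization OnePoint

noncomputable section

/-- The skew-product `(z, w) ↦ (f z + w * h z, g w)`. -/
def skewProduct (f g h : ℂ → ℂ) : ℂ × ℂ → ℂ × ℂ :=
  fun p => (f p.1 + p.2 * h p.1, g p.2)

/-! ### Normality with respect to the one-point compactification of `ℂ²` -/

/-- The sequence `u` diverges to infinity, uniformly on compact subsets of `U`. -/
def DivergesOnCompacts (u : ℕ → ℂ × ℂ → ℂ × ℂ) (U : Set (ℂ × ℂ)) : Prop :=
  ∀ K : Set (ℂ × ℂ), K ⊆ U → IsCompact K →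
    ∀ R : ℝ, ∀ᶠ n in atTop, ∀ p ∈ K, R ≤ ‖u n p‖

/-- Every sequence in the family `𝓕` either diverges to infinity uniformly on compact subsets
of `U`, or has a subsequence converging uniformly on compact subsets of `U` to a
holomorphic map `U → ℂ²`. -/
def IsOnePointNormalOn (𝓕 : Set (ℂ × ℂ → ℂ × ℂ)) (U : Set (ℂ × ℂ)) : Prop :=
  ∀ u : ℕ → ℂ × ℂ → ℂ × ℂ, (∀ n, u n ∈ 𝓕) →
    DivergesOnCompacts u U ∨
    ∃ σ : ℕ → ℕ, StrictMono σ ∧ ∃ φ : ℂ × ℂ → ℂ × ℂ, DifferentiableOn ℂ φ U ∧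
      ∀ K : Set (ℂ × ℂ), K ⊆ U → IsCompact K →
        TendstoUniformlyOn (fun n => u (σ n)) φ atTop K

/-! ### Normality with respect to the complex projective plane -/

/-- The complex projective plane. -/
abbrev ProjPlane : Type := ℙ ℂ (EuclideanSpace ℂ (Fin 3))

/-- The vector `(1, z, w)` of `ℂ³` is nonzero. -/
theorem one_cons_ne_zero (p : ℂ × ℂ) :
    (!₂[1, p.1, p.2] : EuclideanSpace ℂ (Fin 3)) ≠ 0 := by
  intro h
  have := congrArg (fun v : EuclideanSpace ℂ (Fin 3) => v 0) h
  simp at this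

/-- The standard embedding `(z, w) ↦ [1 : z : w]` of `ℂ²` in the projective plane. -/
def toProjPlane (p : ℂ × ℂ) : ProjPlane :=
  Projectivization.mk ℂ !₂[1, p.1, p.2] (one_cons_ne_zero p)

/-- The Fubini–Study distance on the projective plane:
the angle between two complex lines of `ℂ³`. -/
def fubiniStudyDist (x y : ProjPlane) : ℝ :=
  Real.arccos (‖inner ℂ x.rep y.rep‖ / (‖x.rep‖ * ‖y.rep‖))

/-- The Fubini–Study distance does not depend on the vectors representing the two points. -/
theorem fubiniStudyDist_mk (u v : EuclideanSpace ℂ (Fin 3)) (hu : u ≠ 0) (hv : v ≠ 0) :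
    fubiniStudyDist (Projectivization.mk ℂ u hu) (Projectivization.mk ℂ v hv) =
      Real.arccos (‖inner ℂ u v‖ / (‖u‖ * ‖v‖)) := by
  obtain ⟨a, ha⟩ := Projectivization.exists_smul_eq_mk_rep ℂ u hu
  obtain ⟨b, hb⟩ := Projectivization.exists_smul_eq_mk_rep ℂ v hv
  have ha0 : ‖(a : ℂ)‖ ≠ 0 := by simp
  have hb0 : ‖(b : ℂ)‖ ≠ 0 := by simp
  have hu0 : ‖u‖ ≠ 0 := by simpa using hu
  have hv0 : ‖v‖ ≠ 0 := by simpa using hv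
  unfold fubiniStudyDist
  rw [← ha, ← hb]
  simp only [Units.smul_def, inner_smul_left, inner_smul_right, norm_mul, norm_smul,
    RCLike.norm_conj]
  congr 1
  field_simp

/-- A map from the open set `U` to the projective plane is holomorphic if locally it is given in
homogeneous coordinates by a holomorphic map to `ℂ³` without zeros. -/
def HolomorphicOnToProjPlane (φ : ℂ × ℂ → ProjPlane) (U : Set (ℂ × ℂ)) : Prop :=
  ∀ p ∈ U, ∃ V : Set (ℂ × ℂ), IsOpen V ∧ p ∈ V ∧ V ⊆ U ∧
    ∃ Φ : ℂ × ℂ → EuclideanSpace ℂ (Fin 3), DifferentiableOn ℂ Φ V ∧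
      ∀ q ∈ V, ∃ hq : Φ q ≠ 0, φ q = Projectivization.mk ℂ (Φ q) hq

/-- Every sequence in the family `𝓕` has a subsequence converging uniformly on compact subsets
of `U` to a holomorphic map from `U` to the projective plane. -/
def IsProjNormalOn (𝓕 : Set (ℂ × ℂ → ℂ × ℂ)) (U : Set (ℂ × ℂ)) : Prop :=
  ∀ u : ℕ → ℂ × ℂ → ℂ × ℂ, (∀ n, u n ∈ 𝓕) →
    ∃ σ : ℕ → ℕ, StrictMono σ ∧ ∃ φ : ℂ × ℂ → ProjPlane, HolomorphicOnToProjPlane φ U ∧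
      ∀ K : Set (ℂ × ℂ), K ⊆ U → IsCompact K →
        ∀ ε > 0, ∀ᶠ n in atTop, ∀ p ∈ K,
          fubiniStudyDist (toProjPlane (u (σ n) p)) (φ p) < ε

/-! ### Normality with respect to the product of two Riemann spheres -/

/-- The chordal distance on the Riemann sphere. -/
def chordalDist : OnePoint ℂ → OnePoint ℂ → ℝ
  | OnePoint.infty, OnePoint.infty => 0
  | OnePoint.infty, OnePoint.some b => 2 / √(1 + ‖b‖ ^ 2)
  | OnePoint.some a, OnePoint.infty => 2 / √(1 + ‖a‖ ^ 2)
  | OnePoint.some a, OnePoint.some b =>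
      2 * ‖a - b‖ / (√(1 + ‖a‖ ^ 2) * √(1 + ‖b‖ ^ 2))

/-- The inverse of the chart of the Riemann sphere at infinity: `ζ ↦ 1 / ζ`, with `0 ↦ ∞`. -/
def sphereInv (ζ : ℂ) : OnePoint ℂ :=
  open Classical in if ζ = 0 then ∞ else ((ζ⁻¹ : ℂ) : OnePoint ℂ)

/-- A map from the open set `U` to the Riemann sphere is holomorphic if near every point of `U`
it takes values in the domain of one of the two standard charts (the finite coordinate `z`, or
`1 / z` near infinity) and is holomorphic in that chart. -/
def HolomorphicOnToSphere (φ : ℂ × ℂ → OnePoint ℂ) (U : Set (ℂ × ℂ)) : Prop :=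
  ∀ p ∈ U, ∃ V : Set (ℂ × ℂ), IsOpen V ∧ p ∈ V ∧ V ⊆ U ∧
    ∃ ψ : ℂ × ℂ → ℂ, DifferentiableOn ℂ ψ V ∧
      ((∀ q ∈ V, φ q = (ψ q : OnePoint ℂ)) ∨ (∀ q ∈ V, φ q = sphereInv (ψ q)))

/-- Every sequence in the family `𝓕` has a subsequence converging uniformly on compact subsets
of `U` to a holomorphic map from `U` to the product of two Riemann spheres, the map
being written as the pair of its components `φ` and `ψ`. -/
def IsSphereProdNormalOn (𝓕 : Set (ℂ × ℂ → ℂ × ℂ)) (U : Set (ℂ × ℂ)) : Prop :=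
  ∀ u : ℕ → ℂ × ℂ → ℂ × ℂ, (∀ n, u n ∈ 𝓕) →
    ∃ σ : ℕ → ℕ, StrictMono σ ∧ ∃ φ ψ : ℂ × ℂ → OnePoint ℂ,
      HolomorphicOnToSphere φ U ∧ HolomorphicOnToSphere ψ U ∧
      ∀ K : Set (ℂ × ℂ), K ⊆ U → IsCompact K →
        ∀ ε > 0, ∀ᶠ n in atTop, ∀ p ∈ K,
          chordalDist ((u (σ n) p).1 : OnePoint ℂ) (φ p) < ε ∧
          chordalDist ((u (σ n) p).2 : OnePoint ℂ) (ψ p) < ε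

/-! ### Fatou and Julia sets -/

/-- The Fatou set of `F` with respect to a notion of normality: the points having an open
neighbourhood on which the iterates of `F` form a normal family. -/
def fatouSet (Normal : Set (ℂ × ℂ → ℂ × ℂ) → Set (ℂ × ℂ) → Prop) (F : ℂ × ℂ → ℂ × ℂ) :
    Set (ℂ × ℂ) :=
  {p | ∃ U : Set (ℂ × ℂ), IsOpen U ∧ p ∈ U ∧ Normal (Set.range fun n : ℕ => F^[n]) U}

/-- The Julia set of `F` with respect to a notion of normality. -/
def juliaSet (Normal : Set (ℂ × ℂ → ℂ × ℂ) → Set (ℂ × ℂ) → Prop) (F : ℂ × ℂ → ℂ × ℂ) :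
    Set (ℂ × ℂ) :=
  (fatouSet Normal F)ᶜ

end

/-!
The function `h` is the limit of a sequence of entire functions, each obtained from the previous one
by a small correction. At each stage a time `n` is taken at which the orbit of `z₀` under `f` leaves
a large disc (`exists_large_step`), and then `w ≠ 0` so small that the orbit of `(z₀, w)` under the
current skew-product follows that of `(z₀, 0)` up to time `n`. As `g^[n] w ≠ 0`, the value of `h` at
the first coordinate of the `n`-th point can be corrected so that the next point of the orbit lies
on `{0} × ℂ`. The correction is a polynomial that vanishes at all orbit points used before and has a
factor `(z / P) ^ N`, where `P` is that first coordinate and `N` is large, which makes it small on a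
large disc (`exists_entire_small_interpolating`, `exists_modification`). Hence the corrections sum to
an entire function, and each corrected orbit is left intact by the later stages (`exists_coupling`).

In the limit, points arbitrarily close to `(z₀, 0)` land in `{0} × closedBall 0 1` at times at which
the orbit of `(z₀, 0)` tends to infinity along `ℂ × {0}`. This contradicts all three notions of
normality (`IsObstruction`). In `ℙ²`, and in the first factor of the product of two spheres, a limit
map would be continuous at `(z₀, 0)`, with value the point at infinity of the line `ℂ × {0}`, but
`{0} × closedBall 0 1` stays away from that point. In `ℂ²`, the iterates do not diverge uniformly
near `(z₀, 0)`, nor does a subsequence converge at `(z₀, 0)`.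
-/

/-! ### Iterates of skew-products -/

theorem skewProduct_iterate_snd (f g h : ℂ → ℂ) (n : ℕ) (p : ℂ × ℂ) :
    ((skewProduct f g h)^[n] p).2 = g^[n] p.2 := by
  induction n with
  | zero => rfl
  | succ n ih => rw [Function.iterate_succ_apply', Function.iterate_succ_apply', ← ih]; rfl

theorem skewProduct_iterate_zero (f g h : ℂ → ℂ) (hg0 : g 0 = 0) (n : ℕ) (z : ℂ) :
    (skewProduct f g h)^[n] (z, 0) = (f^[n] z, 0) := by
  induction n with
  | zero => rfl
  | succ n ih =>
    rw [Function.iterate_succ_apply', Function.iterate_succ_apply', ih]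
    simp [skewProduct, hg0]

theorem continuous_skewProduct {f g h : ℂ → ℂ} (hf : Continuous f) (hg : Continuous g)
    (hh : Continuous h) : Continuous (skewProduct f g h) := by
  unfold skewProduct
  fun_prop

/-- The first `n` steps of an orbit only see the values of `h` at the first coordinates of the
first `n` points of that orbit. -/
theorem skewProduct_iterate_congr {f g h h' : ℂ → ℂ} {n : ℕ} {p : ℂ × ℂ}
    (hh : ∀ j < n, h' ((skewProduct f g h)^[j] p).1 = h ((skewProduct f g h)^[j] p).1) :
    (skewProduct f g h')^[n] p = (skewProduct f g h)^[n] p := by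
  induction n with
  | zero => rfl
  | succ n ih =>
    rw [Function.iterate_succ_apply', Function.iterate_succ_apply',
      ih fun j hj => hh j (hj.trans n.lt_succ_self)]
    simp only [skewProduct, hh n n.lt_succ_self]

/-! ### Entire functions -/

/-- A nonconstant entire function fixing `0` maps small punctured neighbourhoods of `0` into
punctured neighbourhoods of `0`, since its zeros are isolated. -/
theorem tendsto_punctured_nhds_zero {g : ℂ → ℂ} (hg : Differentiable ℂ g)
    (hg_nonconst : ¬ ∃ c : ℂ, ∀ w : ℂ, g w = c) (hg0 : g 0 = 0) :
    Tendsto g (𝓝[≠] 0) (𝓝[≠] 0) := by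
  have hne : ∀ᶠ w in 𝓝[≠] (0 : ℂ), g w ≠ 0 := by
    refine ((hg.analyticAt 0).eventually_eq_zero_or_eventually_ne_zero).resolve_left fun h => ?_
    have hana : AnalyticOnNhd ℂ g Set.univ := fun z _ => hg.analyticAt z
    exact hg_nonconst ⟨0, fun w => hana.eqOn_zero_of_preconnected_of_eventuallyEq_zero
      isPreconnected_univ (Set.mem_univ 0) h (Set.mem_univ w)⟩
  refine tendsto_nhdsWithin_iff.2 ⟨?_, hne⟩
  have := hg.continuous.tendsto 0
  rw [hg0] at this
  exact this.mono_left nhdsWithin_le_nhds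

/-- An entire function with a prescribed value at one point can be made small on a disc not
containing that point, and zero on a finite set not containing it. -/
theorem exists_entire_small_interpolating (T : Finset ℂ) {P : ℂ} (hPT : P ∉ T) {R : ℝ}
    (hR : 0 ≤ R) (hRP : R < ‖P‖) (c : ℂ) {ε : ℝ} (hε : 0 < ε) :
    ∃ q : ℂ → ℂ, Differentiable ℂ q ∧ q P = c ∧ (∀ s ∈ T, q s = 0) ∧
      ∀ z, ‖z‖ ≤ R → ‖q z‖ ≤ ε := by
  have hP : 0 < ‖P‖ := hR.trans_lt hRP
  have hP0 : P ≠ 0 := norm_pos_iff.1 hP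
  set Q : ℂ → ℂ := fun z => c / (∏ s ∈ T, (P - s)) * ∏ s ∈ T, (z - s) with hQ
  have hQd : Differentiable ℂ Q := by fun_prop
  have hQP : Q P = c := by
    have : ∏ s ∈ T, (P - s) ≠ 0 :=
      Finset.prod_ne_zero_iff.2 fun s hs h => hPT (by rwa [sub_eq_zero.1 h])
    simp only [hQ]
    field_simp
  obtain ⟨C, hC⟩ := (isCompact_closedBall (0 : ℂ) R).exists_bound_of_continuousOn
    hQd.continuous.continuousOn
  have hlim : Tendsto (fun N : ℕ => C * (R / ‖P‖) ^ N) atTop (𝓝 (C * 0)) :=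
    (tendsto_pow_atTop_nhds_zero_of_lt_one (by positivity) ((div_lt_one hP).2 hRP)).const_mul C
  rw [mul_zero] at hlim
  obtain ⟨N, hN⟩ := (hlim.eventually (ge_mem_nhds hε)).exists
  refine ⟨fun z => Q z * (z / P) ^ N, by fun_prop, ?_, ?_, ?_⟩
  · simp [hQP, hP0]
  · intro s hs
    simp [hQ, Finset.prod_eq_zero hs (sub_self s)]
  · intro z hz
    have h1 : ‖Q z‖ ≤ C := hC z (by simpa using hz)
    have h0 : 0 ≤ C := (norm_nonneg _).trans h1
    rw [norm_mul, norm_pow, norm_div]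
    exact le_trans (by gcongr) hN

/-- Entire functions whose consecutive differences are summably small on growing discs converge
to an entire function. -/
theorem exists_entire_limit {h : ℕ → ℂ → ℂ} (hd : ∀ k, Differentiable ℂ (h k))
    (hh : ∀ k : ℕ, ∀ z : ℂ, ‖z‖ ≤ k → ‖h (k + 1) z - h k z‖ ≤ 1 / 2 ^ k) :
    ∃ H : ℂ → ℂ, Differentiable ℂ H ∧ ∀ z, Tendsto (fun k => h k z) atTop (𝓝 (H z)) := by
  have hdist : ∀ (N : ℕ) (z : ℂ), ‖z‖ ≤ N →
      ∀ n : ℕ, dist (h (n + N) z) (h (n + 1 + N) z) ≤ 2 / 2 / 2 ^ n := by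
    intro N z hz n
    rw [dist_comm, dist_eq_norm, add_right_comm, div_self two_ne_zero]
    refine (hh (n + N) z (hz.trans (by push_cast; linarith [n.cast_nonneg (α := ℝ)]))).trans ?_
    gcongr
    · norm_num
    · omega
  have hlim : ∀ z, ∃ a, Tendsto (fun k => h k z) atTop (𝓝 a) := by
    intro z
    obtain ⟨N, hN⟩ := exists_nat_ge ‖z‖
    obtain ⟨a, ha⟩ := cauchySeq_tendsto_of_complete
      (cauchySeq_of_le_geometric_two (hdist N z hN))
    exact ⟨a, (tendsto_add_atTop_iff_nat N).1 ha⟩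
  choose H hH using hlim
  refine ⟨H, fun z => ?_, hH⟩
  obtain ⟨N, hN⟩ := exists_nat_gt ‖z‖
  have hunif : TendstoUniformlyOn (fun n => h (n + N)) H atTop (Metric.ball 0 N) := by
    rw [Metric.tendstoUniformlyOn_iff]
    intro ε hε
    have h0 : Tendsto (fun n : ℕ => (2 : ℝ) * (1 / 2) ^ n) atTop (𝓝 (2 * 0)) :=
      (tendsto_pow_atTop_nhds_zero_of_lt_one (by norm_num) (by norm_num)).const_mul 2
    rw [mul_zero] at h0
    filter_upwards [h0.eventually (gt_mem_nhds hε)] with n hn x hx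
    rw [mem_ball_zero_iff] at hx
    rw [dist_comm]
    refine (dist_le_of_le_geometric_two_of_tendsto (hdist N x hx.le)
      ((tendsto_add_atTop_iff_nat N).2 (hH x)) n).trans_lt ?_
    simpa [div_eq_mul_inv] using hn
  exact (hunif.tendstoLocallyUniformlyOn.differentiableOn
    (Eventually.of_forall fun n => (hd _).differentiableOn) Metric.isOpen_ball).differentiableAt
    (Metric.isOpen_ball.mem_nhds (by simpa using hN))

/-! ### Construction of the coupling function -/

/-- Along an unbounded orbit there is a step from a point of large norm to a point of large norm
such that the point left behind has not been visited before. -/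
theorem exists_large_step {f : ℂ → ℂ} (hf : Continuous f) {z₀ : ℂ}
    (hz₀ : ∀ M : ℝ, ∃ n, M < ‖f^[n] z₀‖) (R B : ℝ) :
    ∃ n, R < ‖f^[n + 1] z₀‖ ∧ B < ‖f^[n] z₀‖ ∧ ∀ j < n, f^[j] z₀ ≠ f^[n] z₀ := by
  classical
  obtain ⟨C, hC⟩ := (isCompact_closedBall (0 : ℂ) B).exists_bound_of_continuousOn hf.continuousOn
  -- The first visit outside the disc of radius `M` works: it is not the starting point, it is not
  -- in the image of the disc of radius `B`, and a repetition before it would give an earlier visit.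
  set M : ℝ := max (max R ‖z₀‖) C with hM
  have hlt := Nat.find_spec (hz₀ M)
  have hmin : ∀ j < Nat.find (hz₀ M), ‖f^[j] z₀‖ ≤ M := fun j hj =>
    not_lt.1 (Nat.find_min (hz₀ M) hj)
  obtain ⟨n, hn⟩ : ∃ n, Nat.find (hz₀ M) = n + 1 := by
    refine Nat.exists_eq_succ_of_ne_zero fun h0 => ?_
    rw [h0] at hlt
    exact absurd hlt (not_lt.2 ((le_max_right R _).trans (le_max_left _ C)))
  rw [hn] at hlt hmin
  refine ⟨n, ((le_max_left R _).trans (le_max_left _ C)).trans_lt hlt, ?_, ?_⟩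
  · by_contra! hB
    have := hC _ (mem_closedBall_zero_iff.2 hB)
    rw [← Function.iterate_succ_apply' f] at this
    exact absurd hlt (not_lt.2 (this.trans (le_max_right _ C)))
  · intro j hj h
    have := hmin (j + 1) (by omega)
    rw [Function.iterate_succ_apply', h, ← Function.iterate_succ_apply' f] at this
    exact absurd hlt (not_lt.2 this)

/-- The inductive step of the construction: an arbitrarily small change of `h` on a given disc,
not affecting given finitely many values, sends a point `(z₀, w)` close to `(z₀, 0)` to the line
`{0} × ℂ` at a time at which the orbit of `(z₀, 0)` is far away. The new function keeps this
property under any later change that does not affect its values on a finite set `S'`. -/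
theorem exists_modification {f g : ℂ → ℂ} (hf : Differentiable ℂ f) (hg : Differentiable ℂ g)
    (hg_nonconst : ¬ ∃ c : ℂ, ∀ w : ℂ, g w = c) (hg0 : g 0 = 0) {z₀ : ℂ}
    (hz₀ : ∀ M : ℝ, ∃ n, M < ‖f^[n] z₀‖) {h : ℂ → ℂ} (hh : Differentiable ℂ h)
    (S : Finset ℂ) {R : ℝ} (hR : 0 ≤ R) {ε : ℝ} (hε : 0 < ε) :
    ∃ (h' : ℂ → ℂ) (S' : Finset ℂ) (w : ℂ) (m : ℕ), Differentiable ℂ h' ∧ S ⊆ S' ∧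
      (∀ s ∈ S, h' s = h s) ∧ (∀ z, ‖z‖ ≤ R → ‖h' z - h z‖ ≤ ε) ∧
      ‖w‖ < ε ∧ R < ‖f^[m] z₀‖ ∧
      ∀ h'' : ℂ → ℂ, (∀ s ∈ S', h'' s = h' s) →
        ((skewProduct f g h'')^[m] (z₀, w)).1 = 0 ∧
        ‖((skewProduct f g h'')^[m] (z₀, w)).2‖ ≤ 1 := by
  classical
  obtain ⟨C, hC⟩ := S.finite_toSet.isBounded.exists_norm_le
  obtain ⟨n, hn1, hn2, hn3⟩ := exists_large_step hf.continuous hz₀ R (max R C)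
  set F := skewProduct f g h with hF
  have hFc : ∀ j, Continuous fun w : ℂ => (F^[j] (z₀, w)).1 := fun j =>
    continuous_fst.comp (((continuous_skewProduct hf.continuous hg.continuous
      hh.continuous).iterate j).comp (by fun_prop))
  have hF0 : ∀ j, (F^[j] (z₀, 0)).1 = f^[j] z₀ := fun j => by
    rw [hF, skewProduct_iterate_zero f g h hg0]
  have hg0' : g^[n + 1] 0 = 0 := Function.iterate_fixed hg0 _
  have e1 : ∀ᶠ w in 𝓝[≠] (0 : ℂ), max R C < ‖(F^[n] (z₀, w)).1‖ :=
    nhdsWithin_le_nhds ((hFc n).norm.continuousAt.eventually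
      (lt_mem_nhds (by simpa only [hF0] using hn2)))
  have e2 : ∀ᶠ w in 𝓝[≠] (0 : ℂ), ∀ j ∈ Finset.range n,
      (F^[j] (z₀, w)).1 ≠ (F^[n] (z₀, w)).1 := by
    rw [Finset.eventually_all]
    intro j hj
    refine nhdsWithin_le_nhds ((isOpen_ne_fun (hFc j) (hFc n)).mem_nhds ?_)
    simpa only [Set.mem_ofPred_eq, hF0] using hn3 j (Finset.mem_range.1 hj)
  have e3 : ∀ᶠ w in 𝓝[≠] (0 : ℂ), g^[n] w ≠ 0 :=
    (tendsto_nhdsWithin_iff.1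
      ((tendsto_punctured_nhds_zero hg hg_nonconst hg0).iterate n)).2
  have e4 : ∀ᶠ w in 𝓝[≠] (0 : ℂ), ‖g^[n + 1] w‖ < 1 :=
    nhdsWithin_le_nhds ((hg.continuous.iterate (n + 1)).norm.continuousAt.eventually
      (gt_mem_nhds (by simp [hg0'])))
  have e5 : ∀ᶠ w in 𝓝[≠] (0 : ℂ), ‖w‖ < ε :=
    nhdsWithin_le_nhds (continuous_norm.continuousAt.eventually
      (gt_mem_nhds (by simpa using hε)))
  obtain ⟨w, h1, h2, h3, h4, h5⟩ := (e1.and (e2.and (e3.and (e4.and e5)))).exists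
  set P : ℂ := (F^[n] (z₀, w)).1 with hP
  set T : Finset ℂ := S ∪ (Finset.range n).image fun j => (F^[j] (z₀, w)).1 with hT
  have hPT : P ∉ T := by
    rw [hT, Finset.mem_union, Finset.mem_image]
    rintro (hS | ⟨j, hj, hjP⟩)
    · exact absurd (hC P hS) (not_le.2 ((le_max_right R C).trans_lt h1))
    · exact h2 j hj hjP
  -- The value of the correction at `P` is chosen so that the next point lies on `{0} × ℂ`.
  obtain ⟨q, hqd, hqP, hqT, hqR⟩ := exists_entire_small_interpolating T hPT hR
    ((le_max_left R C).trans_lt h1) (-f P / g^[n] w - h P) hε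
  refine ⟨fun z => h z + q z, insert P T, w, n + 1, hh.add hqd, ?_, ?_, ?_, h5, hn1, ?_⟩
  · exact Finset.subset_union_left.trans (Finset.subset_insert _ _)
  · intro s hs
    simp [hqT s (Finset.mem_union_left _ hs)]
  · intro z hz
    simpa using hqR z hz
  · intro h'' hh''
    have hn : (skewProduct f g h'')^[n] (z₀, w) = F^[n] (z₀, w) := by
      refine skewProduct_iterate_congr fun j hj => ?_
      have hjT : (F^[j] (z₀, w)).1 ∈ T :=
        Finset.mem_union_right _ (Finset.mem_image_of_mem _ (Finset.mem_range.2 hj))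
      have := hh'' _ (Finset.mem_insert_of_mem hjT)
      simpa only [hqT _ hjT, add_zero] using this
    constructor
    · rw [Function.iterate_succ_apply', hn]
      change f P + (F^[n] (z₀, w)).2 * h'' P = 0
      rw [hh'' P (Finset.mem_insert_self _ _), hF, skewProduct_iterate_snd]
      simp only [hqP]
      field_simp
      ring
    · rw [skewProduct_iterate_snd]
      exact h4.le

/-- There is a coupling function `h` for which points `(z₀, w k)` tending to `(z₀, 0)` reach the
set `{0} × closedBall 0 1` at times at which the orbit of `(z₀, 0)` tends to infinity. -/
theorem exists_coupling {f g : ℂ → ℂ} (hf : Differentiable ℂ f) (hg : Differentiable ℂ g)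
    (hg_nonconst : ¬ ∃ c : ℂ, ∀ w : ℂ, g w = c) (hg0 : g 0 = 0) {z₀ : ℂ}
    (hz₀ : ∀ M : ℝ, ∃ n, M < ‖f^[n] z₀‖) :
    ∃ (h : ℂ → ℂ) (w : ℕ → ℂ) (m : ℕ → ℕ), Differentiable ℂ h ∧
      Tendsto w atTop (𝓝 0) ∧ Tendsto (fun k => ‖f^[m k] z₀‖) atTop atTop ∧
      (∀ k, ((skewProduct f g h)^[m k] (z₀, w k)).1 = 0) ∧
      ∀ k, ‖((skewProduct f g h)^[m k] (z₀, w k)).2‖ ≤ 1 := by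
  have step := fun (s : {h : ℂ → ℂ // Differentiable ℂ h} × Finset ℂ) (k : ℕ) =>
    exists_modification hf hg hg_nonconst hg0 hz₀ s.1.2 s.2 k.cast_nonneg
      (show (0 : ℝ) < 1 / 2 ^ k by positivity)
  choose H S' W M hHd hSS hHS hHR hW hM hfin using step
  let s : ℕ → {h : ℂ → ℂ // Differentiable ℂ h} × Finset ℂ := fun k =>
    Nat.rec (⟨fun _ => 0, differentiable_const 0⟩, ∅)
      (fun k s => (⟨H s k, hHd s k⟩, S' s k)) k
  obtain ⟨h, hhd, hh⟩ := exists_entire_limit (h := fun k => (s k).1.1) (fun k => (s k).1.2)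
    fun k z hz => hHR (s k) k z hz
  -- The values on the finite set of stage `k` are never changed afterwards.
  have hstable : ∀ k, ∀ x ∈ (s k).2, h x = (s k).1.1 x := by
    intro k x hx
    have hj : ∀ j, x ∈ (s (k + j)).2 ∧ (s (k + j)).1.1 x = (s k).1.1 x := by
      intro j
      induction j with
      | zero => exact ⟨hx, rfl⟩
      | succ j ih =>
        exact ⟨hSS (s (k + j)) (k + j) ih.1, (hHS (s (k + j)) (k + j) x ih.1).trans ih.2⟩
    refine tendsto_nhds_unique (hh x) (tendsto_const_nhds.congr' ?_)
    filter_upwards [eventually_ge_atTop k] with i hi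
    obtain ⟨j, rfl⟩ := Nat.exists_eq_add_of_le hi
    exact (hj j).2.symm
  refine ⟨h, fun k => W (s k) k, fun k => M (s k) k, hhd, ?_, ?_, ?_, ?_⟩
  · refine squeeze_zero_norm (fun k => (hW (s k) k).le) ?_
    simpa using tendsto_pow_atTop_nhds_zero_of_lt_one
      (show (0 : ℝ) ≤ 1 / 2 by norm_num) (by norm_num)
  · exact tendsto_atTop_mono (fun k => (hM (s k) k).le) tendsto_natCast_atTop_atTop
  · exact fun k => (hfin (s k) k h (hstable (k + 1))).1
  · exact fun k => (hfin (s k) k h (hstable (k + 1))).2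

/-! ### Criteria for non-normality -/

/-- The common obstruction to the three notions of normality at `p₀`: the maps `u k` send `p₀` to
infinity along the line `ℂ × {0}`, and points `p k` tending to `p₀` to a bounded part of the line
`{0} × ℂ`. -/
structure IsObstruction (u : ℕ → ℂ × ℂ → ℂ × ℂ) (p₀ : ℂ × ℂ) (p : ℕ → ℂ × ℂ) : Prop where
  tendsto : Tendsto p atTop (𝓝 p₀)
  tendsto_fst : Tendsto (fun k => ‖(u k p₀).1‖) atTop atTop
  snd_eq_zero : ∀ k, (u k p₀).2 = 0
  fst_eq_zero : ∀ k, (u k (p k)).1 = 0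
  norm_snd_le : ∀ k, ‖(u k (p k)).2‖ ≤ 1

namespace IsObstruction

variable {u : ℕ → ℂ × ℂ → ℂ × ℂ} {p₀ : ℂ × ℂ} {p : ℕ → ℂ × ℂ}

theorem comp (h : IsObstruction u p₀ p) {σ : ℕ → ℕ} (hσ : StrictMono σ) :
    IsObstruction (fun k => u (σ k)) p₀ (fun k => p (σ k)) where
  tendsto := h.tendsto.comp hσ.tendsto_atTop
  tendsto_fst := h.tendsto_fst.comp hσ.tendsto_atTop
  snd_eq_zero _ := h.snd_eq_zero _
  fst_eq_zero _ := h.fst_eq_zero _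
  norm_snd_le _ := h.norm_snd_le _

theorem exists_compact (h : IsObstruction u p₀ p) {U : Set (ℂ × ℂ)} (hU : IsOpen U)
    (hp₀ : p₀ ∈ U) : ∃ K ⊆ U, IsCompact K ∧ p₀ ∈ K ∧ ∀ᶠ k in atTop, p k ∈ K := by
  obtain ⟨K, hK, hKU, hKc⟩ := local_compact_nhds (hU.mem_nhds hp₀)
  exact ⟨K, hKU, hKc, mem_of_mem_nhds hK, h.tendsto hK⟩

/-- The bounded values at the points `p k` exclude divergence, the unbounded values at `p₀` exclude
a convergent subsequence. -/
theorem not_isOnePointNormalOn (h : IsObstruction u p₀ p) {𝓕 : Set (ℂ × ℂ → ℂ × ℂ)}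
    (hu : ∀ k, u k ∈ 𝓕) {U : Set (ℂ × ℂ)} (hU : IsOpen U) (hp₀ : p₀ ∈ U) :
    ¬ IsOnePointNormalOn 𝓕 U := by
  intro hN
  obtain ⟨K, hKU, hKc, hp₀K, hpK⟩ := h.exists_compact hU hp₀
  rcases hN u hu with hdiv | ⟨σ, hσ, φ, -, hφ⟩
  · obtain ⟨k, hk, hk'⟩ := ((hdiv K hKU hKc 2).and hpK).exists
    have h1 := hk _ hk'
    rw [Prod.norm_def, h.fst_eq_zero k, norm_zero] at h1
    exact absurd (h1.trans (max_le zero_le_one (h.norm_snd_le k))) (by norm_num)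
  · have h1 := ((hφ K hKU hKc).tendsto_at hp₀K).fst_nhds.norm
    exact not_tendsto_atTop_of_tendsto_nhds h1 (h.comp hσ).tendsto_fst

end IsObstruction

/-! ### The projective plane -/

/-- Fubini–Study convergence to `0`, in terms of the cosines of the angles. -/
theorem tendsto_cos_of_fubiniStudyDist {v v' : ℕ → EuclideanSpace ℂ (Fin 3)}
    (hv : ∀ k, v k ≠ 0)
    (h : ∀ ε > 0, ∀ᶠ k in atTop, ∃ hv' : v' k ≠ 0, fubiniStudyDist
      (Projectivization.mk ℂ (v k) (hv k)) (Projectivization.mk ℂ (v' k) hv') < ε) :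
    Tendsto (fun k => ‖inner ℂ (v k) (v' k)‖ / (‖v k‖ * ‖v' k‖)) atTop (𝓝 1) := by
  have h0 : Tendsto (fun k => Real.arccos (‖inner ℂ (v k) (v' k)‖ / (‖v k‖ * ‖v' k‖)))
      atTop (𝓝 0) := by
    rw [Metric.tendsto_nhds]
    intro ε hε
    filter_upwards [h ε hε] with k ⟨hv', hk⟩
    rw [fubiniStudyDist_mk] at hk
    rwa [Real.dist_eq, sub_zero, abs_of_nonneg (Real.arccos_nonneg _)]
  have h1 := (Real.continuous_cos.tendsto 0).comp h0
  rw [Real.cos_zero] at h1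
  refine h1.congr fun k => Real.cos_arccos ?_ ?_
  · exact (by norm_num : (-1 : ℝ) ≤ 0).trans (by positivity)
  · exact div_le_one_of_le₀ (norm_inner_le_norm _ _) (by positivity)

theorem inner_vec (p : ℂ × ℂ) (v : EuclideanSpace ℂ (Fin 3)) :
    inner ℂ !₂[1, p.1, p.2] v = v 0 + v 1 * star p.1 + v 2 * star p.2 := by
  simp [PiLp.inner_apply, Fin.sum_univ_three]

/-- A limit map sends `p₀` to `[0 : 1 : 0]` by the values at `p₀`, but by continuity the values at
the points `p k`, which are all orthogonal to this line, would have to approach it. -/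
theorem IsObstruction.not_isProjNormalOn {u : ℕ → ℂ × ℂ → ℂ × ℂ} {p₀ : ℂ × ℂ}
    {p : ℕ → ℂ × ℂ} (h : IsObstruction u p₀ p) {𝓕 : Set (ℂ × ℂ → ℂ × ℂ)}
    (hu : ∀ k, u k ∈ 𝓕) {U : Set (ℂ × ℂ)} (hU : IsOpen U) (hp₀ : p₀ ∈ U) :
    ¬ IsProjNormalOn 𝓕 U := by
  intro hN
  obtain ⟨σ, hσ, φ, hφ, hconv⟩ := hN u hu
  replace h := h.comp hσ
  obtain ⟨K, hKU, hKc, hp₀K, hpK⟩ := h.exists_compact hU hp₀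
  obtain ⟨V, hV, hp₀V, -, Φ, hΦd, hΦ⟩ := hφ p₀ hp₀
  have hΦc : ContinuousAt Φ p₀ := (hΦd.differentiableAt (hV.mem_nhds hp₀V)).continuousAt
  obtain ⟨hΦ0, -⟩ := hΦ p₀ hp₀V
  have hΦp : Tendsto (fun k => Φ (p (σ k))) atTop (𝓝 (Φ p₀)) := hΦc.tendsto.comp h.tendsto
  have hn0 : 0 < ‖Φ p₀‖ := norm_pos_iff.2 hΦ0
  -- The angle at `p₀`: the limit point has to be `[0 : 1 : 0]`.
  have hcos₀ := tendsto_cos_of_fubiniStudyDist (v := fun k => !₂[1, (u (σ k) p₀).1, (u (σ k) p₀).2])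
    (v' := fun _ => Φ p₀) (fun k => one_cons_ne_zero _) (by
      intro ε hε
      filter_upwards [hconv K hKU hKc ε hε] with k hk
      obtain ⟨hq, hq'⟩ := hΦ p₀ hp₀V
      refine ⟨hq, ?_⟩
      rw [← hq']
      exact hk p₀ hp₀K)
  have hle : ‖Φ p₀‖ ≤ ‖Φ p₀ 1‖ := by
    have hbound : ∀ᶠ k in atTop, ‖inner ℂ !₂[1, (u (σ k) p₀).1, (u (σ k) p₀).2] (Φ p₀)‖ /
        (‖!₂[1, (u (σ k) p₀).1, (u (σ k) p₀).2]‖ * ‖Φ p₀‖) ≤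
        (‖Φ p₀ 0‖ * ‖(u (σ k) p₀).1‖⁻¹ + ‖Φ p₀ 1‖) / ‖Φ p₀‖ := by
      filter_upwards [h.tendsto_fst.eventually_gt_atTop 0] with k hk
      have h2 : (u (σ k) p₀).2 = 0 := h.snd_eq_zero k
      have h3 : ‖(u (σ k) p₀).1‖ ≤
          ‖(!₂[1, (u (σ k) p₀).1, (u (σ k) p₀).2] : EuclideanSpace ℂ (Fin 3))‖ :=
        PiLp.norm_apply_le (!₂[1, (u (σ k) p₀).1, (u (σ k) p₀).2] : EuclideanSpace ℂ (Fin 3)) 1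
      rw [inner_vec, ← div_div]
      gcongr
      calc _ ≤ ‖Φ p₀ 0 + Φ p₀ 1 * star (u (σ k) p₀).1 + Φ p₀ 2 * star (u (σ k) p₀).2‖ /
            ‖(u (σ k) p₀).1‖ := by gcongr
        _ ≤ (‖Φ p₀ 0‖ + ‖Φ p₀ 1‖ * ‖(u (σ k) p₀).1‖) / ‖(u (σ k) p₀).1‖ := by
          gcongr
          rw [h2, star_zero, mul_zero, add_zero]
          exact (norm_add_le _ _).trans (by rw [norm_mul, norm_star])
        _ = _ := by field_simp
    have hlim : Tendsto (fun k => (‖Φ p₀ 0‖ * ‖(u (σ k) p₀).1‖⁻¹ + ‖Φ p₀ 1‖) / ‖Φ p₀‖) atTop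
        (𝓝 ((‖Φ p₀ 0‖ * 0 + ‖Φ p₀ 1‖) / ‖Φ p₀‖)) :=
      ((h.tendsto_fst.inv_tendsto_atTop.const_mul _).add_const _).div_const _
    have := le_of_tendsto_of_tendsto hcos₀ hlim hbound
    rwa [mul_zero, zero_add, le_div_iff₀ hn0, one_mul] at this
  have hsq : ‖Φ p₀‖ ^ 2 = ‖Φ p₀ 0‖ ^ 2 + ‖Φ p₀ 1‖ ^ 2 + ‖Φ p₀ 2‖ ^ 2 := by
    simp [EuclideanSpace.norm_sq_eq, Fin.sum_univ_three]
  have hle2 : ‖Φ p₀‖ ^ 2 ≤ ‖Φ p₀ 1‖ ^ 2 := by gcongr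
  have hz0 : Φ p₀ 0 = 0 := by
    rw [← norm_eq_zero, ← sq_eq_zero_iff]
    nlinarith [sq_nonneg ‖Φ p₀ 0‖, sq_nonneg ‖Φ p₀ 2‖]
  have hz2 : Φ p₀ 2 = 0 := by
    rw [← norm_eq_zero, ← sq_eq_zero_iff]
    nlinarith [sq_nonneg ‖Φ p₀ 0‖, sq_nonneg ‖Φ p₀ 2‖]
  -- The angles at the points `p k`: the images have vanishing middle homogeneous coordinate.
  obtain ⟨N, hN⟩ := eventually_atTop.1 (hpK.and (h.tendsto (hV.mem_nhds hp₀V)))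
  have hcos := tendsto_cos_of_fubiniStudyDist
    (v := fun k => !₂[1, (u (σ k) (p (σ k))).1, (u (σ k) (p (σ k))).2])
    (v' := fun k => Φ (p (σ k))) (fun k => one_cons_ne_zero _) (by
      intro ε hε
      filter_upwards [hconv K hKU hKc ε hε, eventually_ge_atTop N] with k hk hkN
      obtain ⟨hq, hq'⟩ := hΦ _ (hN k hkN).2
      refine ⟨hq, ?_⟩
      rw [← hq']
      exact hk _ (hN k hkN).1)
  have hbound : ∀ k, ‖inner ℂ !₂[1, (u (σ k) (p (σ k))).1, (u (σ k) (p (σ k))).2]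
      (Φ (p (σ k)))‖ / (‖!₂[1, (u (σ k) (p (σ k))).1, (u (σ k) (p (σ k))).2]‖ *
        ‖Φ (p (σ k))‖) ≤ (‖Φ (p (σ k)) 0‖ + ‖Φ (p (σ k)) 2‖) / ‖Φ (p (σ k))‖ := by
    intro k
    have h1 : (u (σ k) (p (σ k))).1 = 0 := h.fst_eq_zero k
    have h2 : ‖(u (σ k) (p (σ k))).2‖ ≤ 1 := h.norm_snd_le k
    have h3 : (1 : ℝ) ≤ ‖(!₂[1, (u (σ k) (p (σ k))).1, (u (σ k) (p (σ k))).2] :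
        EuclideanSpace ℂ (Fin 3))‖ := by
      simpa using PiLp.norm_apply_le
        (!₂[1, (u (σ k) (p (σ k))).1, (u (σ k) (p (σ k))).2] : EuclideanSpace ℂ (Fin 3)) 0
    rw [inner_vec, ← div_div]
    gcongr
    refine (div_le_self (norm_nonneg _) h3).trans ?_
    rw [h1, star_zero, mul_zero, add_zero]
    refine (norm_add_le _ _).trans ?_
    rw [norm_mul, norm_star]
    gcongr
    exact mul_le_of_le_one_right (norm_nonneg _) h2
  have hcoord : ∀ i, Tendsto (fun k => ‖Φ (p (σ k)) i‖) atTop (𝓝 ‖Φ p₀ i‖) := fun i =>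
    ((PiLp.continuous_apply 2 _ i).tendsto _ |>.comp hΦp).norm
  have hlim := ((hcoord 0).add (hcoord 2)).div hΦp.norm hn0.ne'
  have := le_of_tendsto_of_tendsto' hcos hlim hbound
  rw [hz0, hz2] at this
  norm_num at this

/-! ### The Riemann sphere -/

theorem chordalDist_coe_coe (a b : ℂ) : chordalDist (a : OnePoint ℂ) (b : OnePoint ℂ) =
    2 * ‖a - b‖ / (√(1 + ‖a‖ ^ 2) * √(1 + ‖b‖ ^ 2)) := rfl

/-- A finite point of the sphere is not a limit of finite points tending to infinity. -/
theorem not_tendsto_chordalDist_coe {a : ℕ → ℂ} (ha : Tendsto (fun k => ‖a k‖) atTop atTop)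
    (b : ℂ) (h : ∀ ε > 0, ∀ᶠ k in atTop, chordalDist (a k : OnePoint ℂ) (b : OnePoint ℂ) < ε) :
    False := by
  have hb : 0 < √(1 + ‖b‖ ^ 2) := by positivity
  obtain ⟨k, hk, hka⟩ := ((h (1 / 2 / √(1 + ‖b‖ ^ 2)) (by positivity)).and
    (ha.eventually_ge_atTop (1 + 2 * ‖b‖))).exists
  rw [chordalDist_coe_coe, ← div_div, div_lt_div_iff_of_pos_right hb] at hk
  have h0 := norm_nonneg b
  have h1 : √(1 + ‖a k‖ ^ 2) ≤ 1 + ‖a k‖ :=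
    Real.sqrt_le_iff.2 ⟨by positivity, by nlinarith⟩
  have h2 : ‖a k‖ - ‖b‖ ≤ ‖a k - b‖ := norm_sub_norm_le _ _
  rw [div_lt_iff₀ (by positivity)] at hk
  linarith

/-- Near infinity, the distance to the origin is bounded below. -/
theorem one_le_chordalDist_zero_sphereInv {ζ : ℂ} (hζ : ‖ζ‖ ≤ 1) :
    1 ≤ chordalDist ((0 : ℂ) : OnePoint ℂ) (sphereInv ζ) := by
  unfold sphereInv
  split_ifs with h0
  · change 1 ≤ 2 / √(1 + ‖(0 : ℂ)‖ ^ 2)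
    norm_num
  · have hζ0 : 0 < ‖ζ‖ := norm_pos_iff.2 h0
    have hinv : 1 ≤ ‖ζ‖⁻¹ := (one_le_inv₀ hζ0).2 hζ
    rw [chordalDist_coe_coe, zero_sub, norm_neg, norm_inv, norm_zero]
    have h1 : √(1 + ‖ζ‖⁻¹ ^ 2) ≤ 2 * ‖ζ‖⁻¹ :=
      Real.sqrt_le_iff.2 ⟨by positivity, by nlinarith⟩
    rw [one_le_div (by positivity)]
    simpa using h1

/-- The first component of a limit map sends `p₀` to infinity, but is close to `0` at the points
`p k`. -/
theorem IsObstruction.not_isSphereProdNormalOn {u : ℕ → ℂ × ℂ → ℂ × ℂ} {p₀ : ℂ × ℂ}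
    {p : ℕ → ℂ × ℂ} (h : IsObstruction u p₀ p) {𝓕 : Set (ℂ × ℂ → ℂ × ℂ)}
    (hu : ∀ k, u k ∈ 𝓕) {U : Set (ℂ × ℂ)} (hU : IsOpen U) (hp₀ : p₀ ∈ U) :
    ¬ IsSphereProdNormalOn 𝓕 U := by
  intro hN
  obtain ⟨σ, hσ, φ, _, hφ, -, hconv⟩ := hN u hu
  replace h := h.comp hσ
  obtain ⟨K, hKU, hKc, hp₀K, hpK⟩ := h.exists_compact hU hp₀
  obtain ⟨V, hV, hp₀V, -, ψ, hψd, hψ⟩ := hφ p₀ hp₀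
  have hψc : ContinuousAt ψ p₀ := (hψd.differentiableAt (hV.mem_nhds hp₀V)).continuousAt
  have hconv₀ : ∀ ε > 0, ∀ᶠ k in atTop,
      chordalDist ((u (σ k) p₀).1 : OnePoint ℂ) (φ p₀) < ε := fun ε hε =>
    (hconv K hKU hKc ε hε).mono fun k hk => (hk p₀ hp₀K).1
  rcases hψ with hψ | hψ
  · rw [hψ p₀ hp₀V] at hconv₀
    exact not_tendsto_chordalDist_coe h.tendsto_fst _ hconv₀
  · by_cases h0 : ψ p₀ = 0
    · have hsmall : ∀ᶠ k in atTop, ‖ψ (p (σ k))‖ < 1 :=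
        h.tendsto.eventually (hψc.norm.eventually (gt_mem_nhds (by simp [h0])))
      obtain ⟨k, hk, hkK, hkV, hk1⟩ := ((hconv K hKU hKc 1 one_pos).and
        (hpK.and ((h.tendsto.eventually (hV.mem_nhds hp₀V)).and hsmall))).exists
      have h1 := (hk _ hkK).1
      have h2 : (u (σ k) (p (σ k))).1 = 0 := h.fst_eq_zero k
      rw [h2, hψ _ hkV] at h1
      exact absurd h1 (not_lt.2 (one_le_chordalDist_zero_sphereInv hk1.le))
    · rw [hψ p₀ hp₀V, sphereInv, if_neg h0] at hconv₀
      exact not_tendsto_chordalDist_coe h.tendsto_fst _ hconv₀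

/-! ### The Julia set -/

theorem theorem1p1 (f g : ℂ → ℂ) (hf : Differentiable ℂ f) (hg : Differentiable ℂ g)
    (hf_nonconst : ¬ ∃ c : ℂ, ∀ z : ℂ, f z = c) (hg_nonconst : ¬ ∃ c : ℂ, ∀ w : ℂ, g w = c)
    (hg0 : g 0 = 0) (z₀ : ℂ)
    (hz₀ : ∃ n : ℕ → ℕ, StrictMono n ∧ Tendsto (fun k => ‖f^[n k] z₀‖) atTop atTop) :
    ∃ h : ℂ → ℂ, Differentiable ℂ h ∧
      (z₀, 0) ∈ juliaSet IsOnePointNormalOn (skewProduct f g h) ∧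
      (z₀, 0) ∈ juliaSet IsProjNormalOn (skewProduct f g h) ∧
      (z₀, 0) ∈ juliaSet IsSphereProdNormalOn (skewProduct f g h) := by
  have hunb : ∀ M : ℝ, ∃ n, M < ‖f^[n] z₀‖ := by
    obtain ⟨n, -, hn⟩ := hz₀
    intro M
    obtain ⟨k, hk⟩ := (hn.eventually_gt_atTop M).exists
    exact ⟨n k, hk⟩
  obtain ⟨h, w, m, hhd, hw, hm, h1, h2⟩ := exists_coupling hf hg hg_nonconst hg0 hunb
  have hobs : IsObstruction (fun k => (skewProduct f g h)^[m k]) (z₀, 0) fun k => (z₀, w k) := by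
    refine ⟨tendsto_const_nhds.prodMk_nhds hw, ?_, ?_, h1, h2⟩
    · simpa only [skewProduct_iterate_zero f g h hg0] using hm
    · intro k
      rw [skewProduct_iterate_zero f g h hg0]
  have hmem : ∀ k, (skewProduct f g h)^[m k] ∈ Set.range fun n : ℕ => (skewProduct f g h)^[n] :=
    fun k => ⟨m k, rfl⟩
  refine ⟨h, hhd, ?_, ?_, ?_⟩
  · rintro ⟨U, hU, hp, hN⟩
    exact hobs.not_isOnePointNormalOn hmem hU hp hN
  · rintro ⟨U, hU, hp, hN⟩
    exact hobs.not_isProjNormalOn hmem hU hp hN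
  · rintro ⟨U, hU, hp, hN⟩
    exact hobs.not_isSphereProdNormalOn hmem hU hp hN
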